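/- Let $G$ be a group. The non-abelian tensor square $G\otimes G$ is the group generated by the symbols $g\otimes h$ ($g,h\in G$) subject to the relations $$gg'\otimes h=({}^{g}g'\otimes{}^{g}h)(g\otimes h),\qquad g\otimes hh'=(g\otimes h)({}^{h}g\otimes{}^{h}h')$$ for all $g,g',h,h'\in G$, where ${}^{x}y=xyx^{-1}$. Let $G^{\varphi}$ be a copy of $G$ via an isomorphism $\varphi: g\mapsto g^{\varphi}$, and let $\nu(G)$ be the quotient of the free product $G*G^{\varphi}$ by the relations $$[g,h^{\varphi}]^{k}=[g^{k},(h^{k})^{\varphi}]=[g,h^{\varphi}]^{k^{\varphi}}\qquad (g,h,k\in G),$$ where $[x,y]=x^{-1}y^{-1}xy$ and $x^{y}=y^{-1}xy$. A group is finite-by-nilpotent if it has a finite normal subgroup with nilpotent quotient (equivalently, some term of its lower central series is finite), and nilpotent-by-finite if it has a nilpotent normal subgroup of finite index. Theorem A. Suppose that $G$ is finite-by-nilpotent. Then (a) the non-abelian tensor square $G\otimes G$ is finite-by-nilpotent, and so is the subgroup $\Upsilon(G)=[G,G^{\varphi}]$ of $\nu(G)$, with which it is usually identified via $g\otimes h\mapsto[g,h^{\varphi}]$;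 (b) the group $\nu(G)$ is nilpotent-by-finite. -/

import Mathlib

open scoped commutatorElement

/-- A group is finite-by-nilpotent if it has a finite normal subgroup with nilpotent quotient. -/
def IsFiniteByNilpotent (G : Type*) [Group G] : Prop :=
  ∃ (N : Subgroup G) (_ : N.Normal), Finite N ∧ Group.IsNilpotent (G ⧸ N)

/-- Equivalently, some term of the lower central series is finite. (In Mathlib the lower central
series starts at index `0`, so that the term of index `k` is `γ_{k+1}(G)`.) -/
theorem isFiniteByNilpotent_iff_lowerCentralSeries (G : Type*) [Group G] :
    IsFiniteByNilpotent G ↔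
      ∃ k : ℕ, 0 < k ∧ Finite ((⊤ : Subgroup G).lowerCentralSeries k) := by
  constructor
  · rintro ⟨N, hN, hfin, hnil⟩
    obtain ⟨n, hn⟩ := Subgroup.nilpotent_iff_lowerCentralSeries.mp hnil
    have hmap := Subgroup.map_lowerCentralSeries (⊤ : Subgroup G) (QuotientGroup.mk' N) n
    rw [← MonoidHom.range_eq_map, QuotientGroup.range_mk', hn, Subgroup.map_eq_bot_iff,
      QuotientGroup.ker_mk'] at hmap
    have hle : (⊤ : Subgroup G).lowerCentralSeries (n + 1) ≤ N :=
      (Subgroup.lowerCentralSeries_antitone (⊤ : Subgroup G) (Nat.le_succ n)).trans hmap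
    exact ⟨n + 1, Nat.succ_pos n, Finite.of_injective _ (Subgroup.inclusion_injective hle)⟩
  · rintro ⟨k, -, hfin⟩
    refine ⟨(⊤ : Subgroup G).lowerCentralSeries k, inferInstance, hfin, ?_⟩
    refine Subgroup.nilpotent_iff_lowerCentralSeries.mpr ⟨k, ?_⟩
    have hmap := Subgroup.map_lowerCentralSeries (⊤ : Subgroup G)
      (QuotientGroup.mk' ((⊤ : Subgroup G).lowerCentralSeries k)) k
    rw [← MonoidHom.range_eq_map, QuotientGroup.range_mk'] at hmap
    rw [← hmap, Subgroup.map_eq_bot_iff, QuotientGroup.ker_mk']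

/-- A group is nilpotent-by-finite if it has a nilpotent normal subgroup with finite quotient. -/
def IsNilpotentByFinite (G : Type*) [Group G] : Prop :=
  ∃ N : Subgroup G, N.Normal ∧ Group.IsNilpotent N ∧ Finite (G ⧸ N)

/-- The relators of the non-abelian tensor square, in left notation (`ᵍh = g h g⁻¹`):
`g g' ⊗ h = (ᵍg' ⊗ ᵍh) (g ⊗ h)` and `g ⊗ h h' = (g ⊗ h) (ʰg ⊗ ʰh')`. -/
def tensorSquareRels (G : Type*) [Group G] : Set (FreeGroup (G × G)) :=
  {r | ∃ g g' h : G, r = FreeGroup.of (g * g', h) *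
      (FreeGroup.of (g * g' * g⁻¹, g * h * g⁻¹) * FreeGroup.of (g, h))⁻¹} ∪
  {r | ∃ g h h' : G, r = FreeGroup.of (g, h * h') *
      (FreeGroup.of (g, h) * FreeGroup.of (h * g * h⁻¹, h * h' * h⁻¹))⁻¹}

/-- The non-abelian tensor square `G ⊗ G` of Brown and Loday: the group generated by the symbols
`g ⊗ h` for `g, h` in `G`, subject to the tensor relations. -/
abbrev TensorSquare (G : Type*) [Group G] : Type _ :=
  PresentedGroup (tensorSquareRels G)

/-- The relators of `ν(G)` in the free product of `G` (left factor) with its copy `G^φ` (right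
factor): both `k [g, h^φ] k⁻¹` and `k^φ [g, h^φ] (k^φ)⁻¹` equal `[k g k⁻¹, (k h k⁻¹)^φ]`.
Here `[x, y] = x y x⁻¹ y⁻¹` and conjugation is on the left; the other usual convention, with
`[x, y] = x⁻¹ y⁻¹ x y` and `xᵏ = k⁻¹ x k`, gives the same elements with `g, h, k` replaced by their
inverses, hence the same set of relators. -/
def nuRels (G : Type*) [Group G] : Set (Monoid.Coprod G G) :=
  {r | ∃ g h k : G, r =
    (Monoid.Coprod.inl k * ⁅(Monoid.Coprod.inl g : Monoid.Coprod G G), Monoid.Coprod.inr h⁆ *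
        (Monoid.Coprod.inl k)⁻¹) *
      ⁅(Monoid.Coprod.inl (k * g * k⁻¹) : Monoid.Coprod G G),
        Monoid.Coprod.inr (k * h * k⁻¹)⁆⁻¹} ∪
  {r | ∃ g h k : G, r =
    (Monoid.Coprod.inr k * ⁅(Monoid.Coprod.inl g : Monoid.Coprod G G), Monoid.Coprod.inr h⁆ *
        (Monoid.Coprod.inr k)⁻¹) *
      ⁅(Monoid.Coprod.inl (k * g * k⁻¹) : Monoid.Coprod G G),
        Monoid.Coprod.inr (k * h * k⁻¹)⁆⁻¹}

/-- The group `ν(G) = ⟨G ∪ G^φ | [g, h^φ]^k = [g^k, (h^k)^φ] = [g, h^φ]^(k^φ)⟩`. -/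
abbrev Nu (G : Type*) [Group G] : Type _ :=
  Monoid.Coprod G G ⧸ Subgroup.normalClosure (nuRels G)

/-- The canonical map `G → ν(G)`, `g ↦ g`. -/
def Nu.left (G : Type*) [Group G] : G →* Nu G :=
  (QuotientGroup.mk' (Subgroup.normalClosure (nuRels G))).comp Monoid.Coprod.inl

/-- The canonical map `G → ν(G)`, `g ↦ g^φ`. -/
def Nu.right (G : Type*) [Group G] : G →* Nu G :=
  (QuotientGroup.mk' (Subgroup.normalClosure (nuRels G))).comp Monoid.Coprod.inr

/-- The subgroup `Υ(G) = [G, G^φ]` of `ν(G)`, the canonical copy of `G ⊗ G` in `ν(G)`. -/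
def Nu.upsilon (G : Type*) [Group G] : Subgroup (Nu G) :=
  ⁅(Nu.left G).range, (Nu.right G).range⁆

/-!
Let `G` be finite-by-nilpotent. The groups `G ⊗ G` and `ν(G)` are central extensions of subgroups
of powers of `G`, and the class of finite-by-nilpotent groups is closed under such extensions.

*Central extensions.* In `G ⊗ G`, the element `g ⊗ h` acts by conjugation as `⁅g, h⁆` acts
diagonally (`TensorSquare.tmul_mul_tmul`), so the kernel of the commutator map `G ⊗ G → G` is
central. The group `ν(G)` has three homomorphisms to `G`: the two projections `fst` and `snd`,
whose kernels meet inside `Υ(G)`, and `fold`, which identifies the two copies of `G`. In `ν(G)`,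
conjugation of the generators of `Υ(G)` depends only on the image under `fold`, and
`⁅t, h^φ⁆ = ⁅fold t, h^φ⁆` for `t` in `Υ(G)` (`Nu.commutator_right_eq`). Hence an element of `Υ(G)`
in the kernel of `fold` is central, so the three maps together embed `ν(G)` modulo a central
subgroup into `G × G × G`. In particular `ν(G)` is itself finite-by-nilpotent, and so is its
subgroup `Υ(G)`.

*Closure.* By theorems of P. Hall (`Subgroup.exists_finiteIndex_upperCentralSeries`) and of Baer
(`Subgroup.finite_lowerCentralSeries_of_finiteIndex`), a group is finite-by-nilpotent if and only
if a term of its upper central series has finite index. The latter property passes to subgroups,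
finite products and central extensions at once (`Subgroup.iInf_comap_upperCentralSeries_le`), and
it exhibits a nilpotent normal subgroup of finite index.
-/

/-! ### Finite index in the upper central series and the theorems of Hall and Baer -/

namespace Subgroup

theorem finiteIndex_of_inv_mul_mem {G α : Type*} [Group G] [Finite α] (H : Subgroup G) (f : G → α)
    (hf : ∀ a b, f a = f b → a⁻¹ * b ∈ H) : H.FiniteIndex := by
  have : Finite (G ⧸ H) := by
    refine Finite.of_injective (fun q : G ⧸ H => f q.out) fun p q hpq => ?_
    have h := hf _ _ hpq
    rwa [← QuotientGroup.eq, QuotientGroup.out_eq', QuotientGroup.out_eq'] at h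
  exact finiteIndex_of_finite_quotient

theorem finiteIndex_centralizer_of_finite {G : Type*} [Group G] (N : Subgroup G) [N.Normal]
    [Finite N] : (centralizer (N : Set G)).FiniteIndex := by
  refine finiteIndex_of_inv_mul_mem _
    (fun g (x : N) => (⟨g * x * g⁻¹, Normal.conj_mem ‹_› _ x.2 g⟩ : N)) fun a b hab => ?_
  rw [mem_centralizer_iff]
  intro x hx
  have h : a * x * a⁻¹ = b * x * b⁻¹ := congrArg Subtype.val (congrFun hab ⟨x, hx⟩)
  calc x * (a⁻¹ * b) = a⁻¹ * (a * x * a⁻¹) * b := by group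
    _ = a⁻¹ * b * x := by rw [h]; group

/-- The key step of P. Hall's theorem. Let `N = γ_{n+2}(G)` be finite, let `C` be its centralizer,
and let `S` be a finite set of representatives of `G / C`. The elements of `γ_{n+1}(G)` that
centralize both `N` and `S` form a subgroup of finite index, and for such an element `l` the map
`y ↦ ⁅l, y⁆` from `C` to `N` is compatible with conjugation by `S`; so commutators of `⁅l, y⁆` with
elements of `G` have the form `⁅l, z⁆` with `z` one step further down the lower central series,
and they reach `⁅l, N⁆ = 1`. -/
theorem relIndex_upperCentralSeries_ne_zero {G : Type*} [Group G] (n : ℕ)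
    [Finite ((⊤ : Subgroup G).lowerCentralSeries (n + 1))] :
    (upperCentralSeries G (n + 2)).relIndex ((⊤ : Subgroup G).lowerCentralSeries n) ≠ 0 := by
  set N := (⊤ : Subgroup G).lowerCentralSeries (n + 1) with hN
  set A := (⊤ : Subgroup G).lowerCentralSeries n with hA
  set C := centralizer (N : Set G) with hC
  have hCfin : C.FiniteIndex := finiteIndex_centralizer_of_finite N
  have hCN : C.Normal := inferInstance
  have hAN : ∀ a ∈ A, ∀ g, ⁅a, g⁆ ∈ N := fun a ha g => commutator_mem_commutator ha (mem_top g)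
  set S : Set G := Set.range (Quotient.out : G ⧸ C → G) with hS
  have hdec : ∀ q : G, ∃ s ∈ S, ∃ c ∈ C, q = s * c := fun q =>
    ⟨(q : G ⧸ C).out, ⟨_, rfl⟩, (q : G ⧸ C).out⁻¹ * q,
      by rw [← QuotientGroup.eq, QuotientGroup.out_eq'], by group⟩
  have hL : (C ⊓ centralizer S).relIndex A ≠ 0 := by
    refine relIndex_inf_ne_zero (hCfin.index_ne_zero ∘ index_eq_zero_of_relIndex_eq_zero) ?_
    have : ((centralizer S).subgroupOf A).FiniteIndex := by
      refine finiteIndex_of_inv_mul_mem _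
        (fun a (q : G ⧸ C) => (⟨⁅(a : G), q.out⁆, hAN a a.2 _⟩ : N)) fun a b hab => ?_
      rw [mem_subgroupOf, mem_centralizer_iff]
      rintro _ ⟨q, rfl⟩
      have h : ⁅(a : G), q.out⁆ = ⁅(b : G), q.out⁆ := congrArg Subtype.val (congrFun hab q)
      rw [commutatorElement_def, commutatorElement_def, mul_left_inj] at h
      push_cast
      calc q.out * ((a : G)⁻¹ * b) = (a : G)⁻¹ * (a * q.out * (a : G)⁻¹) * b := by group
        _ = _ := by rw [h]; group
    exact this.index_ne_zero
  suffices hle : (C ⊓ centralizer S) ⊓ A ≤ upperCentralSeries G (n + 2) from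
    fun h0 => hL <| by
      rw [← inf_relIndex_right] at h0 ⊢
      exact Nat.eq_zero_of_zero_dvd (h0 ▸ relIndex_dvd_of_le_left A (le_inf hle inf_le_right))
  rintro l ⟨⟨hlC, hlS⟩, hlA⟩
  replace hlC := mem_centralizer_iff.mp hlC
  replace hlS := mem_centralizer_iff.mp hlS
  have key : ∀ j ≤ n + 1, ∀ y ∈ (⊤ : Subgroup G).lowerCentralSeries (n + 1 - j), y ∈ C →
      ⁅l, y⁆ ∈ upperCentralSeries G j := by
    intro j
    induction j with
    | zero =>
      intro _ y hy _
      rw [commutatorElement_eq_one_iff_mul_comm.mpr (hlC y hy).symm]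
      exact one_mem _
    | succ j ih =>
      intro hj y hy hyC q
      obtain ⟨s, hs, c, hc, rfl⟩ := hdec q
      have hw : ⁅l, y⁆ ∈ N := hAN l hlA y
      have hz : ⁅l, ⁅s, y⁆⁆ ∈ upperCentralSeries G j := by
        refine ih (by omega) _ ?_ ?_
        · have : n + 1 - j = n + 1 - (j + 1) + 1 := by omega
          rw [this, ← commutatorElement_inv]
          exact inv_mem (commutator_mem_commutator hy (mem_top s))
        · exact mul_mem (hCN.conj_mem _ hyC s) (inv_mem hyC)
      have hzC : ⁅s, y⁆ ∈ C := mul_mem (hCN.conj_mem _ hyC s) (inv_mem hyC)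
      have h1 : c * ⁅l, y⁆ * c⁻¹ = ⁅l, y⁆ := by
        rw [← mem_centralizer_iff.mp hc _ hw, mul_inv_cancel_right]
      have h2 : s * l * s⁻¹ = l := by rw [hlS s hs, mul_inv_cancel_right]
      have h3 : ⁅s, y⁆ * ⁅l, y⁆ * ⁅s, y⁆⁻¹ = ⁅l, y⁆ := by
        rw [← mem_centralizer_iff.mp hzC _ hw, mul_inv_cancel_right]
      -- The commutator of `⁅l, y⁆` with `s c` is again of the form `⁅l, z⁆`, with `z = ⁅s, y⁆`.
      have h4 : ⁅s * c, ⁅l, y⁆⁆ = ⁅l, ⁅s, y⁆⁆ := by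
        calc ⁅s * c, ⁅l, y⁆⁆ = s * (c * ⁅l, y⁆ * c⁻¹) * s⁻¹ * ⁅l, y⁆⁻¹ := by
              rw [commutatorElement_def (s * c)]; group
          _ = ⁅s * l * s⁻¹, ⁅s, y⁆ * y⁆ * ⁅l, y⁆⁻¹ := by
              rw [h1]; simp only [commutatorElement_def]; group
          _ = ⁅l, ⁅s, y⁆⁆ * (⁅s, y⁆ * ⁅l, y⁆ * ⁅s, y⁆⁻¹) * ⁅l, y⁆⁻¹ := by
              rw [h2]; simp only [commutatorElement_def]; group
          _ = _ := by rw [h3, mul_inv_cancel_right]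
      rw [← commutatorElement_inv, h4]
      exact inv_mem hz
  intro q
  obtain ⟨s, hs, c, hc, rfl⟩ := hdec q
  have hcZ : ⁅l, c⁆ ∈ upperCentralSeries G (n + 1) :=
    key (n + 1) le_rfl c (by rw [Nat.sub_self]; exact mem_top c) hc
  have : ⁅l, s * c⁆ = s * ⁅l, c⁆ * s⁻¹ := by
    rw [commutatorElement_mul_right_eq_mul_conj,
      commutatorElement_eq_one_iff_mul_comm.mpr (hlS s hs).symm, one_mul]
  rw [this]
  exact Normal.conj_mem inferInstance _ hcZ s

theorem comap_upperCentralSeries_quotient_le {G : Type*} [Group G] (k m : ℕ) :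
    (upperCentralSeries (G ⧸ upperCentralSeries G k) m).comap
      (QuotientGroup.mk' (upperCentralSeries G k)) ≤ upperCentralSeries G (m + k) := by
  induction m with
  | zero =>
    rw [upperCentralSeries_zero, MonoidHom.comap_bot, QuotientGroup.ker_mk', zero_add]
  | succ m ih =>
    intro x hx
    rw [Nat.succ_add]
    intro y
    refine ih ?_
    rw [mem_comap, map_commutatorElement]
    exact mem_upperCentralSeries_succ_iff.mp hx _

/-- **P. Hall's theorem**: if some term of the lower central series of `G` is finite, then some term
of the upper central series of `G` has finite index. -/
theorem exists_finiteIndex_upperCentralSeries (n : ℕ) :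
    ∀ (G : Type*) [Group G], Finite ((⊤ : Subgroup G).lowerCentralSeries n) →
      ∃ m, (upperCentralSeries G m).FiniteIndex := by
  induction n with
  | zero =>
    intro G _ hfin
    have : Finite G := (Equiv.Set.univ G).finite_iff.mp hfin
    exact ⟨0, inferInstance⟩
  | succ n ih =>
    intro G _ hfin
    have hrel := relIndex_upperCentralSeries_ne_zero (G := G) n
    set Z := upperCentralSeries G (n + 2)
    have hmap : ((⊤ : Subgroup G).lowerCentralSeries n).map (QuotientGroup.mk' Z) =
        (⊤ : Subgroup (G ⧸ Z)).lowerCentralSeries n := by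
      rw [map_lowerCentralSeries, ← MonoidHom.range_eq_map, QuotientGroup.range_mk']
    obtain ⟨m, hm⟩ := ih (G ⧸ Z) <| by
      rw [← hmap]
      refine Nat.finite_of_card_ne_zero ?_
      rwa [← relIndex_ker, QuotientGroup.ker_mk']
    have hm' : ((upperCentralSeries (G ⧸ Z) m).comap (QuotientGroup.mk' Z)).FiniteIndex :=
      ⟨by rw [index_comap_of_surjective _ (QuotientGroup.mk'_surjective Z)]; exact hm.index_ne_zero⟩
    exact ⟨m + (n + 2), finiteIndex_of_le (comap_upperCentralSeries_quotient_le (n + 2) m)⟩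

/-- Central extensions shift the upper central series by at most one step. The family `f` stands for
a single homomorphism to a product of copies of `Q`. -/
theorem iInf_comap_upperCentralSeries_le {ι H Q : Type*} [Group H] [Group Q] (f : ι → H →* Q)
    (hf : ⨅ i, (f i).ker ≤ center H) (m : ℕ) :
    ⨅ i, (upperCentralSeries Q m).comap (f i) ≤ upperCentralSeries H (m + 1) := by
  induction m with
  | zero => rw [zero_add, upperCentralSeries_one]; exact hf
  | succ m ih =>
    intro x hx y
    refine ih (mem_iInf.mpr fun i => ?_)
    have := mem_iInf.mp hx i (f i y)
    rwa [← map_commutatorElement] at this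

/-- The three subgroups lemma modulo a normal subgroup. -/
theorem commutator_commutator_le_of_rotate {G : Type*} [Group G] {A B C N : Subgroup G} [N.Normal]
    (h1 : ⁅⁅B, C⁆, A⁆ ≤ N) (h2 : ⁅⁅C, A⁆, B⁆ ≤ N) : ⁅⁅A, B⁆, C⁆ ≤ N := by
  rw [← QuotientGroup.ker_mk' N, ← map_eq_bot_iff, map_commutator, map_commutator] at *
  exact commutator_commutator_eq_bot_of_rotate h1 h2

theorem commutator_lowerCentralSeries_upperCentralSeries_le (G : Type*) [Group G] (i : ℕ) :
    ∀ j, ⁅(⊤ : Subgroup G).lowerCentralSeries i, upperCentralSeries G (i + j + 1)⁆ ≤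
      upperCentralSeries G j := by
  induction i with
  | zero =>
    intro j
    rw [commutator_comm, zero_add]
    exact commutator_upperCentralSeries_top_le G j
  | succ i ih =>
    intro j
    refine commutator_commutator_le_of_rotate ?_ ?_
    · rw [commutator_comm, commutator_comm ⊤]
      refine le_trans (commutator_mono le_rfl (commutator_upperCentralSeries_top_le G _)) ?_
      convert ih j using 3
      omega
    · rw [commutator_comm (upperCentralSeries G _)]
      refine le_trans (commutator_mono ?_ le_rfl) (commutator_upperCentralSeries_top_le G j)
      convert ih (j + 1) using 3
      omega

open scoped IsMulCommutative in
/-- If a normal subgroup `A` is finite modulo the center of `G` and its centralizer has finite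
index, then there are only finitely many commutators `⁅a, g⁆`, and a power map that is a
homomorphism on `A` (the transfer into the center of `A`) kills all of them. So `⁅A, G⁆` is a
finitely generated group of finite exponent, with a center of finite index. -/
theorem finite_commutator_top {G : Type*} [Group G] (A : Subgroup G) [A.Normal]
    (hA : (center G).relIndex A ≠ 0) [(centralizer (A : Set G)).FiniteIndex] :
    Finite (⁅A, ⊤⁆ : Subgroup G) := by
  have hZA : ((center G).subgroupOf A).FiniteIndex := ⟨hA⟩
  have hfg : Group.FG (⁅A, ⊤⁆ : Subgroup G) := by
    -- `⁅a, g⁆` depends only on `a` modulo the center and on `g` modulo the centralizer of `A`.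
    rw [Group.fg_iff_subgroup_fg, fg_iff]
    refine ⟨{g | ∃ a ∈ A, ∃ b ∈ (⊤ : Subgroup G), ⁅a, b⁆ = g}, rfl, ?_⟩
    refine (Set.finite_range fun p : (A ⧸ (center G).subgroupOf A) ×
      (G ⧸ centralizer (A : Set G)) => ⁅(p.1.out : G), p.2.out⁆).subset ?_
    rintro _ ⟨a, ha, g, -, rfl⟩
    refine ⟨((⟨a, ha⟩ : A), g), ?_⟩
    dsimp only
    obtain ⟨⟨z, hz⟩, hza⟩ := QuotientGroup.mk_out_eq_mul ((center G).subgroupOf A) ⟨a, ha⟩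
    obtain ⟨⟨c, hc⟩, hcg⟩ := QuotientGroup.mk_out_eq_mul (centralizer (A : Set G)) g
    rw [hza, hcg]
    have h1 : a * c = c * a := mem_centralizer_iff.mp hc a ha
    have h2 : ∀ x, x * (z : G) = z * x := mem_center_iff.mp (mem_subgroupOf.mp hz)
    have h3 : (z : G) * c = c * z := mem_centralizer_iff.mp hc z z.2
    push_cast
    simp only [commutatorElement_def, mul_inv_rev]
    calc a * z * (g * c) * ((z : G)⁻¹ * a⁻¹) * (c⁻¹ * g⁻¹)
        = a * (z * g) * (c * (z : G)⁻¹) * a⁻¹ * (c⁻¹ * g⁻¹) := by group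
      _ = a * (z * g) * ((z : G)⁻¹ * c) * a⁻¹ * (c⁻¹ * g⁻¹) := by
          rw [(show Commute c (z : G) from h3.symm).inv_right.eq]
      _ = a * (g * z) * ((z : G)⁻¹ * c) * a⁻¹ * (c⁻¹ * g⁻¹) := by rw [← h2 g]
      _ = a * g * (c * a⁻¹) * c⁻¹ * g⁻¹ := by group
      _ = a * g * (a⁻¹ * c) * c⁻¹ * g⁻¹ := by
          rw [(show Commute c a from h1.symm).inv_right.eq]
      _ = a * g * a⁻¹ * g⁻¹ := by group
  have hcA : (center A).FiniteIndex := by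
    refine finiteIndex_of_le (H := (center G).subgroupOf A) fun z hz => ?_
    exact mem_center_iff.mpr fun x => Subtype.ext (mem_center_iff.mp (mem_subgroupOf.mp hz) x)
  set n := (center A).index with hn
  set k := ((center G).subgroupOf A).index with hk
  have hpow : ∀ b ∈ (⁅A, ⊤⁆ : Subgroup G), b ^ (n * k) = 1 := by
    -- The transfer gives a central `n`-th power in `A` only; a further `k`-th power makes the values
    -- central in `G`, so that `σ` takes the same value on `a` and on its conjugates.
    set σ : A →* center A := (powMonoidHom k).comp (MonoidHom.transferCenterPow A) with hσ
    have hσa : ∀ a : A, ((σ a : A) : G) = (a : G) ^ (n * k) := fun a => by simp [hσ, pow_mul, hn]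
    have hle : (⁅A, ⊤⁆ : Subgroup G) ≤ σ.ker.map A.subtype := by
      refine commutator_le.mpr fun a ha g _ => ?_
      set b : A := ⟨g * a⁻¹ * g⁻¹, Normal.conj_mem ‹_› _ (inv_mem ha) g⟩ with hb
      refine ⟨⟨a, ha⟩ * b, ?_, by simp [hb, commutatorElement_def, mul_assoc]⟩
      have hc : a ^ (n * k) ∈ center G := by
        rw [mul_comm, pow_mul]
        exact pow_mem (mem_subgroupOf.mp (pow_index_mem ((center G).subgroupOf A) ⟨a, ha⟩)) n
      rw [SetLike.mem_coe, MonoidHom.mem_ker, map_mul]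
      refine Subtype.ext (Subtype.ext ?_)
      push_cast
      rw [hσa, hσa]
      simp only [hb]
      rw [conj_pow, inv_pow, mem_center_iff.mp (inv_mem hc) g]
      simp
    intro b hb
    obtain ⟨a, ha, rfl⟩ := hle hb
    rw [SetLike.mem_coe, MonoidHom.mem_ker] at ha
    have := hσa a
    rw [ha] at this
    simpa using this.symm
  have hnk : n * k ≠ 0 := mul_ne_zero hcA.index_ne_zero hZA.index_ne_zero
  set B := (⁅A, ⊤⁆ : Subgroup G) with hB
  have hcB : (center B).FiniteIndex := by
    have hBA : B ≤ A := commutator_le_left A ⊤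
    have : ((center G).subgroupOf B).FiniteIndex :=
      ⟨fun h => hA (relIndex_eq_zero_of_le_right hBA h)⟩
    refine finiteIndex_of_le (H := (center G).subgroupOf B) fun z hz => ?_
    exact mem_center_iff.mpr fun x => Subtype.ext (mem_center_iff.mp (mem_subgroupOf.mp hz) x)
  have hcfg : Group.FG (center B) := inferInstance
  have hcfin : Finite (center B) :=
    CommGroup.finite_of_fg_isMulTorsion _ fun z => by
    refine isOfFinOrder_iff_pow_eq_one.mpr ⟨n * k, Nat.pos_of_ne_zero hnk, ?_⟩
    exact Subtype.ext (Subtype.ext (by simpa using hpow _ (z : B).2))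
  exact Finite.of_subgroup_quotient (center B)

/-- **Baer's theorem**: if a term of the upper central series of `G` has finite index, then the
corresponding term of the lower central series of `G` is finite. -/
theorem finite_lowerCentralSeries_of_finiteIndex (m : ℕ) :
    ∀ (G : Type*) [Group G], (upperCentralSeries G m).FiniteIndex →
      Finite ((⊤ : Subgroup G).lowerCentralSeries m) := by
  induction m with
  | zero =>
    intro G _ h
    rw [upperCentralSeries_zero] at h
    have : Finite G := Nat.finite_of_card_ne_zero (index_bot (G := G) ▸ h.index_ne_zero)
    infer_instance
  | succ m ih =>
    intro G _ h
    have hfin := ih (G ⧸ center G) <| by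
      rw [← comap_upperCentralSeries_quotient_center] at h
      refine ⟨?_⟩
      rw [← index_comap_of_surjective _ (QuotientGroup.mk'_surjective (center G))]
      exact h.index_ne_zero
    have hmap : ((⊤ : Subgroup G).lowerCentralSeries m).map (QuotientGroup.mk' (center G)) =
        (⊤ : Subgroup (G ⧸ center G)).lowerCentralSeries m := by
      rw [map_lowerCentralSeries, ← MonoidHom.range_eq_map, QuotientGroup.range_mk']
    have hcent : upperCentralSeries G (m + 1) ≤
        centralizer ((⊤ : Subgroup G).lowerCentralSeries m : Set G) := by
      rw [← commutator_eq_bot_iff_le_centralizer, commutator_comm, eq_bot_iff]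
      exact commutator_lowerCentralSeries_upperCentralSeries_le G m 0
    have := finiteIndex_of_le hcent
    refine finite_commutator_top _ ?_
    rw [← hmap] at hfin
    nth_rewrite 1 [← QuotientGroup.ker_mk' (center G)]
    rw [relIndex_ker]
    exact Nat.card_pos.ne'

end Subgroup

open Subgroup

/-! ### Closure properties of finite-by-nilpotent groups -/

theorem IsFiniteByNilpotent.exists_finiteIndex_upperCentralSeries {G : Type*} [Group G]
    (hG : IsFiniteByNilpotent G) : ∃ m, (Subgroup.upperCentralSeries G m).FiniteIndex := by
  obtain ⟨k, -, hk⟩ := (isFiniteByNilpotent_iff_lowerCentralSeries G).mp hG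
  exact Subgroup.exists_finiteIndex_upperCentralSeries k G hk

theorem IsFiniteByNilpotent.of_finiteIndex_upperCentralSeries {G : Type*} [Group G] {m : ℕ}
    (h : (Subgroup.upperCentralSeries G m).FiniteIndex) : IsFiniteByNilpotent G :=
  (isFiniteByNilpotent_iff_lowerCentralSeries G).mpr ⟨m + 1, m.succ_pos,
    finite_lowerCentralSeries_of_finiteIndex (m + 1) G
      (finiteIndex_of_le (Subgroup.upperCentralSeries_mono G m.le_succ))⟩

/-- A group with finitely many homomorphisms to a finite-by-nilpotent group whose kernels meet in
the center is finite-by-nilpotent. -/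
theorem IsFiniteByNilpotent.of_iInf_ker_le_center {ι H Q : Type*} [Finite ι] [Group H] [Group Q]
    (hQ : IsFiniteByNilpotent Q) (f : ι → H →* Q) (hf : ⨅ i, (f i).ker ≤ center H) :
    IsFiniteByNilpotent H := by
  obtain ⟨m, hm⟩ := hQ.exists_finiteIndex_upperCentralSeries
  refine .of_finiteIndex_upperCentralSeries (m := m + 1) ?_
  have : ∀ i, ((Subgroup.upperCentralSeries Q m).comap (f i)).FiniteIndex := fun i => by
    refine ⟨?_⟩
    rw [index_comap]
    exact hm.index_ne_zero ∘ index_eq_zero_of_relIndex_eq_zero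
  have := finiteIndex_iInf this
  exact finiteIndex_of_le (iInf_comap_upperCentralSeries_le f hf m)

theorem IsFiniteByNilpotent.isNilpotentByFinite {G : Type*} [Group G]
    (hG : IsFiniteByNilpotent G) : IsNilpotentByFinite G := by
  obtain ⟨m, hm⟩ := hG.exists_finiteIndex_upperCentralSeries
  refine ⟨Subgroup.upperCentralSeries G m, inferInstance, ⟨m + 1, eq_top_iff.mpr fun x _ => ?_⟩,
    inferInstance⟩
  refine iInf_comap_upperCentralSeries_le (fun _ : Unit => (Subgroup.upperCentralSeries G m).subtype)
    ?_ m (mem_iInf.mpr fun _ => x.2)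
  simp

/-! ### The kernel of the commutator map on the tensor square -/

namespace TensorSquare

variable {G : Type*} [Group G]

/-- The generator `g ⊗ h` of the non-abelian tensor square. -/
def tmul (g h : G) : TensorSquare G :=
  PresentedGroup.of (g, h)

theorem mul_tmul (g g' h : G) :
    tmul (g * g') h = tmul (g * g' * g⁻¹) (g * h * g⁻¹) * tmul g h :=
  PresentedGroup.mk_eq_mk_of_mul_inv_mem (Or.inl ⟨g, g', h, rfl⟩)

theorem tmul_mul (g h h' : G) :
    tmul g (h * h') = tmul g h * tmul (h * g * h⁻¹) (h * h' * h⁻¹) :=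
  PresentedGroup.mk_eq_mk_of_mul_inv_mem (Or.inr ⟨g, h, h', rfl⟩)

variable (G) in
/-- The commutator map `G ⊗ G → G`, `g ⊗ h ↦ ⁅g, h⁆`. -/
def commutatorMap : TensorSquare G →* G :=
  PresentedGroup.toGroup (f := fun p : G × G => ⁅p.1, p.2⁆) <| by
    rintro _ (⟨g, g', h, rfl⟩ | ⟨g, h, h', rfl⟩) <;>
      simp [commutatorElement_def, mul_assoc]

theorem commutatorMap_tmul (g h : G) : commutatorMap G (tmul g h) = ⁅g, h⁆ :=
  PresentedGroup.toGroup.of _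

/-- The two ways of expanding `g g' ⊗ h h'` show that `g ⊗ h` acts on `G ⊗ G` by conjugation as
`⁅g, h⁆` acts diagonally. -/
theorem tmul_mul_tmul (g h a b : G) :
    tmul (⁅g, h⁆ * a * ⁅g, h⁆⁻¹) (⁅g, h⁆ * b * ⁅g, h⁆⁻¹) * tmul g h = tmul g h * tmul a b := by
  have key : ∀ g' h' : G, tmul (g * h * g' * (g * h)⁻¹) (g * h * h' * (g * h)⁻¹) * tmul g h =
      tmul g h * tmul (h * g * g' * (h * g)⁻¹) (h * g * h' * (h * g)⁻¹) := by
    intro g' h'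
    have h1 : tmul (g * g') (h * h') = tmul (g * g' * g⁻¹) (g * h * g⁻¹) *
        tmul (g * h * g' * (g * h)⁻¹) (g * h * h' * (g * h)⁻¹) *
        (tmul g h * tmul (h * g * h⁻¹) (h * h' * h⁻¹)) := by
      rw [mul_tmul, tmul_mul g, (by group : g * (h * h') * g⁻¹ = (g * h * g⁻¹) * (g * h' * g⁻¹)),
        tmul_mul]
      congr! 3 <;> group
    have h2 : tmul (g * g') (h * h') = tmul (g * g' * g⁻¹) (g * h * g⁻¹) * tmul g h *
        (tmul (h * g * g' * (h * g)⁻¹) (h * g * h' * (h * g)⁻¹) *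
          tmul (h * g * h⁻¹) (h * h' * h⁻¹)) := by
      rw [tmul_mul, mul_tmul g, (by group : h * (g * g') * h⁻¹ = (h * g * h⁻¹) * (h * g' * h⁻¹)),
        mul_tmul (h * g * h⁻¹)]
      congr! 3 <;> group
    have h3 := h1.symm.trans h2
    refine mul_left_cancel (a := tmul (g * g' * g⁻¹) (g * h * g⁻¹))
      (mul_right_cancel (b := tmul (h * g * h⁻¹) (h * h' * h⁻¹)) ?_)
    simpa only [mul_assoc] using h3
  have h1 : ∀ x, ⁅g, h⁆ * x * ⁅g, h⁆⁻¹ = g * h * ((h * g)⁻¹ * x * (h * g)) * (g * h)⁻¹ :=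
    fun x => by rw [commutatorElement_def]; group
  have h2 : ∀ x, h * g * ((h * g)⁻¹ * x * (h * g)) * (h * g)⁻¹ = x := fun x => by group
  rw [h1, h1, key, h2, h2]

theorem mul_tmul_eq (t : TensorSquare G) (a b : G) :
    t * tmul a b = tmul (commutatorMap G t * a * (commutatorMap G t)⁻¹)
      (commutatorMap G t * b * (commutatorMap G t)⁻¹) * t := by
  let S : Subgroup (TensorSquare G) :=
  { carrier := {t | ∀ a b, t * tmul a b = tmul (commutatorMap G t * a * (commutatorMap G t)⁻¹)
      (commutatorMap G t * b * (commutatorMap G t)⁻¹) * t}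
    one_mem' := by simp
    mul_mem' := by
      intro s t hs ht a b
      rw [mul_assoc, ht, ← mul_assoc, hs, mul_assoc, map_mul]
      simp only [mul_inv_rev, mul_assoc]
    inv_mem' := by
      intro t ht a b
      rw [inv_mul_eq_iff_eq_mul, ← mul_assoc, ht]
      simp [mul_assoc] }
  refine PresentedGroup.generated_by _ S (fun p a b => ?_) t a b
  exact (commutatorMap_tmul p.1 p.2 ▸ tmul_mul_tmul p.1 p.2 a b).symm

theorem ker_commutatorMap_le_center : (commutatorMap G).ker ≤ center (TensorSquare G) := by
  intro t ht
  rw [mem_center_iff]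
  intro x
  have := PresentedGroup.generated_by _ (centralizer {t}) (fun p => by
    rw [mem_centralizer_singleton_iff]
    have h := mul_tmul_eq t p.1 p.2
    rw [MonoidHom.mem_ker.mp ht] at h
    simpa [tmul] using h.symm) x
  exact mem_centralizer_singleton_iff.mp this

end TensorSquare

/-! ### The central kernel in `ν(G)` -/

namespace Nu

variable {G : Type*} [Group G]

theorem left_conj_commutator (g h k : G) : left G k * ⁅left G g, right G h⁆ * (left G k)⁻¹ =
    ⁅left G (k * g * k⁻¹), right G (k * h * k⁻¹)⁆ := by
  rw [← mul_inv_eq_one]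
  exact (QuotientGroup.eq_one_iff _).mpr (subset_normalClosure (Or.inl ⟨g, h, k, rfl⟩))

theorem right_conj_commutator (g h k : G) : right G k * ⁅left G g, right G h⁆ * (right G k)⁻¹ =
    ⁅left G (k * g * k⁻¹), right G (k * h * k⁻¹)⁆ := by
  rw [← mul_inv_eq_one]
  exact (QuotientGroup.eq_one_iff _).mpr (subset_normalClosure (Or.inr ⟨g, h, k, rfl⟩))

/-- `ν(G)` is generated by `G` and `G^φ`. -/
theorem subgroup_eq_top (S : Subgroup (Nu G)) (hl : ∀ g, left G g ∈ S) (hr : ∀ g, right G g ∈ S) :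
    S = ⊤ := by
  refine eq_top_iff.mpr fun x _ => ?_
  obtain ⟨w, rfl⟩ := QuotientGroup.mk'_surjective _ x
  induction w using Monoid.Coprod.induction_on with
  | inl g => exact hl g
  | inr g => exact hr g
  | mul x y hx hy => rw [map_mul]; exact mul_mem (hx trivial) (hy trivial)

variable (G) in
/-- The map `ν(G) → G` that is the identity on both copies of `G`. -/
def fold : Nu G →* G :=
  QuotientGroup.lift _ (Monoid.Coprod.lift (.id G) (.id G)) <| normalClosure_le_normal <| by
    rintro _ (⟨g, h, k, rfl⟩ | ⟨g, h, k, rfl⟩) <;>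
      simp [commutatorElement_def, mul_assoc, MonoidHom.mem_ker]

variable (G) in
/-- The map `ν(G) → G` that is the identity on `G` and trivial on `G^φ`. -/
def fst : Nu G →* G :=
  QuotientGroup.lift _ Monoid.Coprod.fst <| normalClosure_le_normal <| by
    rintro _ (⟨g, h, k, rfl⟩ | ⟨g, h, k, rfl⟩) <;>
      simp [commutatorElement_def, mul_assoc, MonoidHom.mem_ker]

variable (G) in
/-- The map `ν(G) → G` that is trivial on `G` and the identity on `G^φ`. -/
def snd : Nu G →* G :=
  QuotientGroup.lift _ Monoid.Coprod.snd <| normalClosure_le_normal <| by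
    rintro _ (⟨g, h, k, rfl⟩ | ⟨g, h, k, rfl⟩) <;>
      simp [commutatorElement_def, mul_assoc, MonoidHom.mem_ker]

@[simp] theorem fold_left (g : G) : fold G (left G g) = g := rfl
@[simp] theorem fold_right (g : G) : fold G (right G g) = g := rfl
@[simp] theorem fst_left (g : G) : fst G (left G g) = g := rfl
@[simp] theorem fst_right (g : G) : fst G (right G g) = 1 := rfl
@[simp] theorem snd_left (g : G) : snd G (left G g) = 1 := rfl
@[simp] theorem snd_right (g : G) : snd G (right G g) = g := rfl

theorem commutator_mem_upsilon (g h : G) : ⁅left G g, right G h⁆ ∈ upsilon G :=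
  commutator_mem_commutator ⟨g, rfl⟩ ⟨h, rfl⟩

theorem upsilon_le_iff {S : Subgroup (Nu G)} :
    upsilon G ≤ S ↔ ∀ g h, ⁅left G g, right G h⁆ ∈ S := by
  refine commutator_le.trans ⟨fun h a b => h _ ⟨a, rfl⟩ _ ⟨b, rfl⟩, ?_⟩
  rintro h _ ⟨a, rfl⟩ _ ⟨b, rfl⟩
  exact h a b

theorem conj_commutator (x : Nu G) (g h : G) : x * ⁅left G g, right G h⁆ * x⁻¹ =
    ⁅left G (fold G x * g * (fold G x)⁻¹), right G (fold G x * h * (fold G x)⁻¹)⁆ := by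
  let S : Subgroup (Nu G) :=
  { carrier := {x | ∀ g h, x * ⁅left G g, right G h⁆ * x⁻¹ =
      ⁅left G (fold G x * g * (fold G x)⁻¹), right G (fold G x * h * (fold G x)⁻¹)⁆}
    one_mem' := by simp
    mul_mem' := by
      intro x y hx hy g h
      calc x * y * ⁅left G g, right G h⁆ * (x * y)⁻¹
          = x * (y * ⁅left G g, right G h⁆ * y⁻¹) * x⁻¹ := by group
        _ = _ := by rw [hy, hx, map_mul (fold G)]; simp only [mul_inv_rev, mul_assoc]
    inv_mem' := by
      intro x hx g h
      have := hx ((fold G x)⁻¹ * g * fold G x) ((fold G x)⁻¹ * h * fold G x)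
      simp only [mul_assoc, mul_inv_cancel, mul_one, mul_inv_cancel_left] at this
      rw [map_inv, inv_inv, inv_inv, ← this]
      simp only [mul_assoc, inv_mul_cancel, mul_one, inv_mul_cancel_left] }
  have hS : S = ⊤ := subgroup_eq_top S (fun k g h => left_conj_commutator g h k)
    (fun k g h => right_conj_commutator g h k)
  exact (hS ▸ mem_top x : x ∈ S) g h

instance : (upsilon G).Normal := by
  refine ⟨fun t ht x => ?_⟩
  have : upsilon G ≤ (upsilon G).comap (MulAut.conj x).toMonoidHom :=
    upsilon_le_iff.mpr fun g h => by
      rw [mem_comap, MulEquiv.coe_toMonoidHom, MulAut.conj_apply, conj_commutator]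
      exact commutator_mem_upsilon _ _
  exact this ht

/-- Conjugation by the two copies of an element of `G` agrees on `Υ(G)`. -/
theorem left_conj_eq_right_conj {t : Nu G} (ht : t ∈ upsilon G) (k : G) :
    left G k * t * (left G k)⁻¹ = right G k * t * (right G k)⁻¹ := by
  have : upsilon G ≤ (MulAut.conj (left G k)).toMonoidHom.eqLocus
      (MulAut.conj (right G k)).toMonoidHom :=
    upsilon_le_iff.mpr fun g h => by
      change left G k * _ * (left G k)⁻¹ = right G k * _ * (right G k)⁻¹
      rw [left_conj_commutator, right_conj_commutator]
  exact this ht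

/-- An element of `Υ(G)` has the same commutators with `G^φ` as its image in the left copy of `G`
under the commutator map. -/
theorem commutator_right_eq {t : Nu G} (ht : t ∈ upsilon G) (h : G) :
    ⁅t, right G h⁆ = ⁅left G (fold G t), right G h⁆ := by
  have hmul : ∀ x y : Nu G, ∀ h : G, ⁅x, right G h⁆ = ⁅left G (fold G x), right G h⁆ →
      ⁅y, right G h⁆ = ⁅left G (fold G y), right G h⁆ →
      ⁅x * y, right G h⁆ = ⁅left G (fold G (x * y)), right G h⁆ := by
    intro x y h hx hy
    rw [commutatorElement_mul_left_eq_conj_mul, hx, hy, conj_commutator, map_mul (fold G),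
      map_mul (left G) (fold G x) (fold G y),
      commutatorElement_mul_left_eq_conj_mul (left G (fold G x)) (left G (fold G y)),
      left_conj_commutator]
  let S : Subgroup (Nu G) :=
  { carrier := {x | ∀ h, ⁅x, right G h⁆ = ⁅left G (fold G x), right G h⁆}
    one_mem' := by simp
    mul_mem' := fun {x y} hx hy h => hmul x y h (hx h) (hy h)
    inv_mem' := by
      intro x hx h
      have h1 : ⁅x⁻¹, right G h⁆ = x⁻¹ * ⁅x, right G h⁆⁻¹ * x := by
        rw [commutatorElement_inv_left, commutatorElement_inv]
      have h2 : ⁅(left G (fold G x))⁻¹, right G h⁆ =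
          (left G (fold G x))⁻¹ * ⁅left G (fold G x), right G h⁆⁻¹ * left G (fold G x) := by
        rw [commutatorElement_inv_left, commutatorElement_inv]
      have h3 := conj_commutator x⁻¹ (fold G x) h
      have h4 := conj_commutator (left G (fold G x))⁻¹ (fold G x) h
      rw [map_inv, map_inv, h1, h2, hx]
      rw [map_inv, inv_inv] at h3
      rw [map_inv, fold_left, inv_inv, ← h3] at h4
      have h5 := congrArg (·⁻¹) h4
      simpa [mul_assoc] using h5.symm }
  have hS : upsilon G ≤ S := by
    refine upsilon_le_iff.mpr fun g k h => ?_
    -- Conjugation by `k` and by `k^φ` agree on the commutators `⁅g⁻¹, h'^φ⁆`, so one copy of `k`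
    -- can be exchanged for the other inside the commutator with `h^φ`.
    have h1 : ⁅right G k * left G g⁻¹ * (right G k)⁻¹, right G h⁆ =
        ⁅left G (k * g⁻¹ * k⁻¹), right G h⁆ := by
      have := right_conj_commutator g⁻¹ (k⁻¹ * h * k) k
      rw [conjugate_commutatorElement] at this
      simpa [mul_assoc] using this
    have h2 : ⁅left G g, right G k⁆ =
        left G g * (right G k * left G g⁻¹ * (right G k)⁻¹) := by
      rw [commutatorElement_def, map_inv]; group
    have h3 : left G (fold G ⁅left G g, right G k⁆) = left G g * left G (k * g⁻¹ * k⁻¹) := by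
      rw [← map_mul, map_commutatorElement, fold_left, fold_right, commutatorElement_def]
      congr 1; group
    rw [h3, h2, commutatorElement_mul_left_eq_conj_mul, h1,
      ← commutatorElement_mul_left_eq_conj_mul]
  exact hS ht h

theorem mem_center_of_fold_eq_one {t : Nu G} (ht : t ∈ upsilon G) (h1 : fold G t = 1) :
    t ∈ center (Nu G) := by
  have hr : ∀ g, right G g * t = t * right G g := fun g => by
    have h := commutator_right_eq ht g
    rw [h1, map_one, commutatorElement_one_left] at h
    exact (commutatorElement_eq_one_iff_mul_comm.mp h).symm
  have hl : ∀ g, left G g * t = t * left G g := fun g => by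
    have h := left_conj_eq_right_conj ht g
    rw [hr, mul_inv_cancel_right, mul_inv_eq_iff_eq_mul] at h
    exact h
  have hS := subgroup_eq_top (centralizer {t}) (fun g => mem_centralizer_singleton_iff.mpr (hl g))
    (fun g => mem_centralizer_singleton_iff.mpr (hr g))
  exact mem_center_iff.mpr fun x => mem_centralizer_singleton_iff.mp (hS ▸ mem_top x)

/-- Modulo `Υ(G)` the two copies of `G` commute. -/
theorem mk_eq (x : Nu G) : (x : Nu G ⧸ upsilon G) =
    (left G (fst G x) * right G (snd G x) : Nu G) := by
  have hcomm : ∀ g h : G, (right G h : Nu G ⧸ upsilon G) * (left G g : Nu G) =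
      (left G g : Nu G) * (right G h : Nu G) := fun g h => by
    refine (commutatorElement_eq_one_iff_mul_comm.mp ?_).symm
    exact (QuotientGroup.eq_one_iff _).mpr (commutator_mem_upsilon g h)
  obtain ⟨w, rfl⟩ := QuotientGroup.mk'_surjective _ x
  induction w using Monoid.Coprod.induction_on with
  | inl g =>
    change (left G g : Nu G ⧸ upsilon G) =
      (left G (fst G (left G g)) * right G (snd G (left G g)) : Nu G)
    simp
  | inr g =>
    change (right G g : Nu G ⧸ upsilon G) =
      (left G (fst G (right G g)) * right G (snd G (right G g)) : Nu G)
    simp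
  | mul x y hx hy =>
    simp only [map_mul, QuotientGroup.mk_mul] at *
    rw [hx, hy, mul_assoc, mul_assoc, ← mul_assoc (QuotientGroup.mk (right G _)), hcomm, mul_assoc]

theorem mem_upsilon_of_eq_one {x : Nu G} (h1 : fst G x = 1) (h2 : snd G x = 1) :
    x ∈ upsilon G := by
  rw [← QuotientGroup.eq_one_iff, mk_eq, h1, h2]
  simp

theorem iInf_ker_le_center : ⨅ i, (![fold G, fst G, snd G] i).ker ≤ center (Nu G) := by
  intro x hx
  have h := mem_iInf.mp hx
  exact mem_center_of_fold_eq_one (mem_upsilon_of_eq_one (h 1) (h 2)) (h 0)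

end Nu

theorem theoremA {G : Type*} [Group G] (hG : IsFiniteByNilpotent G) :
    (IsFiniteByNilpotent (TensorSquare G) ∧ IsFiniteByNilpotent (Nu.upsilon G)) ∧
      IsNilpotentByFinite (Nu G) := by
  have hnu : IsFiniteByNilpotent (Nu G) := hG.of_iInf_ker_le_center _ Nu.iInf_ker_le_center
  refine ⟨⟨?_, ?_⟩, hnu.isNilpotentByFinite⟩
  · exact hG.of_iInf_ker_le_center (fun _ : Unit => TensorSquare.commutatorMap G)
      (by simpa using TensorSquare.ker_commutatorMap_le_center)
  · exact hnu.of_iInf_ker_le_center (fun _ : Unit => (Nu.upsilon G).subtype) (by simp)
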